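/- Let $M$ be a simply laced Coxeter diagram with finite node set $I$ (any two distinct nodes $i,j$ are either joined by a single bond, written $i\sim j$, or not joined; we also write $i\not\sim i$), and suppose that $M$ is spherical, i.e. its Coxeter group $W$ is finite. Let $\Phi^+$ be the set of positive roots of the Coxeter system of type $M$: the images of the simple roots $\alpha_i$ under $W$, acting by the reflections $v\mapsto v-2(\alpha_i,v)\alpha_i$ where $(\alpha_i,\alpha_j)=-\cos(\pi/m_{ij})$, that have nonnegative coefficients with respect to the simple roots. Here $m_{ii}=1$, $m_{ij}=3$ if $i\sim j$, and $m_{ij}=2$ otherwise. Let $l,x$ be indeterminates, let $m=(l-l^{-1})/(1-x)$, and let $B=B(M)$ be the BMW algebra of type $M$: the unital associative algebra over $\mathbb{Q}(l,x)$ presented by generators $g_i,e_i$ $(i\in I)$ and the relations $$\begin{array}{ll} g_ig_j=g_jg_i & \text{if } i\not\sim j,\\ g_ig_jg_i=g_jg_ig_j & \text{if } i\sim j,\\ m e_i=l(g_i^2+mg_i-1) & \text{for all } i,\\ g_ie_i=l^{-1}e_i & \text{for all } i,\\ e_ig_je_i=l e_i & \text{if } i\sim j. \end{array}$$ Then $B$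 is finite dimensional over $\mathbb{Q}(l,x)$. Moreover, $\Phi^+$ is finite, every $g_i$ is invertible in $B$, and for every word $w$ in the letters $g_i,g_i^{-1},e_i$ $(i\in I)$ whose length is greater than $|\Phi^+|$, the element of $B$ represented by $w$ is a $\mathbb{Q}(l,x)$-linear combination of elements represented by words in the same letters of length strictly smaller than the length of $w$. -/

import Mathlib

noncomputable section

namespace SimplyLacedBMW

/-! ### Coxeter diagrams -/

section Coxeter

variable {ι : Type*} (M : CoxeterMatrix ι)

/-- `M` is simply laced: two distinct nodes are either not joined (`M i j = 2`) or joined by a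
single bond (`M i j = 3`). -/
def IsSimplyLaced : Prop := ∀ i j : ι, i ≠ j → M i j = 2 ∨ M i j = 3

/-- `M` is spherical: its Coxeter group is finite. -/
def IsSpherical : Prop := Finite M.Group

/-- `i ∼ j`: the nodes `i` and `j` are joined by a (single) bond. -/
def Adj (i j : ι) : Prop := M i j = 3

/-- The standard symmetric bilinear form on simple roots: `(α_i, α_j) = -cos (π / M i j)`
(so `(α_i, α_i) = 1`; the entry `M i j = 0`, which means `∞`, gives `-1`). -/
def rootForm (i j : ι) : ℝ := -Real.cos (Real.pi / (M i j : ℝ))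

/-- The fundamental reflection `v ↦ v - 2 (α_i, v) α_i` on the real vector space with basis the
simple roots `α_i = Finsupp.single i 1`. -/
def reflection (i : ι) (v : ι →₀ ℝ) : ι →₀ ℝ :=
  v - (2 * v.sum fun j a => a * rootForm M i j) • Finsupp.single i 1

/-- The root system `Φ`: the set of all images of simple roots under the Coxeter group. -/
inductive IsRoot : (ι →₀ ℝ) → Prop
  | simple (i : ι) : IsRoot (Finsupp.single i 1)
  | reflect (i : ι) (v : ι →₀ ℝ) : IsRoot v → IsRoot (reflection M i v)

/-- The set `Φ⁺` of positive roots: roots all of whose coefficients with respect to the simple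
roots are nonnegative. -/
def positiveRoots : Set (ι →₀ ℝ) := {v | IsRoot M v ∧ ∀ i, 0 ≤ v i}

end Coxeter

/-! ### The field of scalars `ℚ(l, x)` -/

/-- The field `ℚ(l, x)` of rational functions in two indeterminates. -/
abbrev Scalars : Type := FractionRing (MvPolynomial (Fin 2) ℚ)

/-- The indeterminate `l`. -/
def lPar : Scalars := algebraMap (MvPolynomial (Fin 2) ℚ) Scalars (MvPolynomial.X 0)

/-- The indeterminate `x`. -/
def xPar : Scalars := algebraMap (MvPolynomial (Fin 2) ℚ) Scalars (MvPolynomial.X 1)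

/-- `m = (l - l⁻¹) / (1 - x)`. -/
def mPar : Scalars := (lPar - lPar⁻¹) / (1 - xPar)

/-! ### The BMW algebra -/

/-- The generating symbols of the presentation. -/
inductive Gen (ι : Type*) : Type _
  | g (i : ι) : Gen ι
  | e (i : ι) : Gen ι

section BMW

variable {ι : Type*} (M : CoxeterMatrix ι)

/-- The symbol `g_i` in the free algebra. -/
def fg (i : ι) : FreeAlgebra Scalars (Gen ι) := FreeAlgebra.ι Scalars (Gen.g i)

/-- The symbol `e_i` in the free algebra. -/
def fe (i : ι) : FreeAlgebra Scalars (Gen ι) := FreeAlgebra.ι Scalars (Gen.e i)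

/-- The defining relations of the BMW algebra of simply laced type `M`. -/
inductive Rel : FreeAlgebra Scalars (Gen ι) → FreeAlgebra Scalars (Gen ι) → Prop
  | B1 (i j : ι) : ¬ Adj M i j → Rel (fg i * fg j) (fg j * fg i)
  | B2 (i j : ι) : Adj M i j → Rel (fg i * fg j * fg i) (fg j * fg i * fg j)
  | D1 (i : ι) : Rel (mPar • fe i) (lPar • (fg i ^ 2 + mPar • fg i - 1))
  | R1 (i : ι) : Rel (fg i * fe i) (lPar⁻¹ • fe i)
  | R2 (i j : ι) : Adj M i j → Rel (fe i * fg j * fe i) (lPar • fe i)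

/-- The BMW algebra `B(M)` over `ℚ(l, x)`, given by generators and relations. -/
abbrev BMW : Type _ := RingQuot (Rel M)

/-- The generator `g_i` of `B(M)`. -/
def g (i : ι) : BMW M := RingQuot.mkAlgHom Scalars (Rel M) (fg i)

/-- The generator `e_i` of `B(M)`. -/
def e (i : ι) : BMW M := RingQuot.mkAlgHom Scalars (Rel M) (fe i)

/-- The letters `g_i`, `g_i⁻¹`, `e_i`. -/
inductive Letter (ι : Type*) : Type _
  | g (i : ι) : Letter ι
  | gInv (i : ι) : Letter ι
  | e (i : ι) : Letter ι

/-- The element of `B(M)` denoted by a letter (`Ring.inverse a` is the inverse of `a` when `a`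
is a unit). -/
def letterVal : Letter ι → BMW M
  | .g i => g M i
  | .gInv i => Ring.inverse (g M i)
  | .e i => e M i

/-- The element of `B(M)` denoted by a word: the product of its letters. -/
def wordVal (w : List (Letter ι)) : BMW M := (w.map (letterVal M)).prod

end BMW

end SimplyLacedBMW

end

/-! To each node `i` attach `V_i`, the span of `1, g_i, e_i`. It contains the letters `g_i`,
`g_i⁻¹`, `e_i`, so a word of letters lies in the product of the `V_i` along its word of nodes. The
relations give `V_i V_i ≤ V_i`, `V_i V_j ≤ V_j V_i` for unjoined nodes, and, for joined nodes, `V_i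
V_j V_i ≤ V_j V_i V_j` up to products of two factors (`nodeSpan_braid_le`). So braid moves on the
node word cost only shorter words, and two equal adjacent nodes shorten the product.

What remains is Coxeter combinatorics: a node word longer than `|Φ⁺|` can be braided into one with
two equal adjacent nodes (`exists_square_of_ncard_lt`). Each letter of a node word gives a root. If
all these roots are nonnegative, they are distinct, which bounds the length by `|Φ⁺|`; if not, an
exchange argument (`IsPositive.nonneg_or_exists`) produces the square.

Finite dimension follows, since words of length at most `|Φ⁺|` span. `Φ` is finite because the
finite group `W` acts on the root space. -/

noncomputable section

namespace SimplyLacedBMW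

/-! ### Roots, braid moves and squares in node words. -/

section Roots

variable {ι : Type*} {M : CoxeterMatrix ι}

/-- Words in the nodes of `M` up to the commutation and braid relations. -/
inductive BraidEquiv (M : CoxeterMatrix ι) : List ι → List ι → Prop
  | refl (u : List ι) : BraidEquiv M u u
  | cons (i : ι) {u v : List ι} : BraidEquiv M u v → BraidEquiv M (i :: u) (i :: v)
  | comm {i j : ι} (h : M i j = 2) (u : List ι) : BraidEquiv M (i :: j :: u) (j :: i :: u)
  | braid {i j : ι} (h : M i j = 3) (u : List ι) :
      BraidEquiv M (i :: j :: i :: u) (j :: i :: j :: u)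
  | trans {u v w : List ι} : BraidEquiv M u v → BraidEquiv M v w → BraidEquiv M u w

namespace BraidEquiv

theorem append_right {u v : List ι} (h : BraidEquiv M u v) (w : List ι) :
    BraidEquiv M (u ++ w) (v ++ w) := by
  induction h with
  | refl u => exact refl _
  | cons i _ ih => exact cons i ih
  | comm h u => exact comm h _
  | braid h u => exact braid h _
  | trans _ _ ih₁ ih₂ => exact ih₁.trans ih₂

theorem length_eq {u v : List ι} (h : BraidEquiv M u v) : u.length = v.length := by
  induction h <;> simp_all

end BraidEquiv

/-- The linear functional `v ↦ (α_i, v)`. -/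
def pairing (M : CoxeterMatrix ι) (i : ι) : (ι →₀ ℝ) →ₗ[ℝ] ℝ :=
  Finsupp.linearCombination ℝ (rootForm M i)

/-- The simple root `α_i`. -/
abbrev simpleRoot (i : ι) : ι →₀ ℝ := Finsupp.single i 1

theorem pairing_simpleRoot (i j : ι) : pairing M i (simpleRoot j) = rootForm M i j := by
  simp [pairing]

theorem reflection_eq (i : ι) (v : ι →₀ ℝ) :
    reflection M i v = v - (2 * pairing M i v) • simpleRoot i := by
  simp [reflection, pairing, Finsupp.linearCombination_apply]

theorem rootForm_self (i : ι) : rootForm M i i = 1 := by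
  simp [rootForm]

theorem rootForm_of_two {i j : ι} (h : M i j = 2) : rootForm M i j = 0 := by
  simp [rootForm, h]

theorem rootForm_of_three {i j : ι} (h : M i j = 3) : rootForm M i j = -(1 / 2) := by
  simp [rootForm, h]

theorem symm_eq {i j : ι} {n : ℕ} (h : M i j = n) : M j i = n := by
  rw [M.symmetric j i, h]

theorem reflection_add (i : ι) (v w : ι →₀ ℝ) :
    reflection M i (v + w) = reflection M i v + reflection M i w := by
  simp only [reflection_eq, map_add, mul_add, add_smul]
  abel

theorem reflection_neg (i : ι) (v : ι →₀ ℝ) : reflection M i (-v) = -reflection M i v := by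
  simp only [reflection_eq, map_neg, mul_neg, neg_smul]
  abel

theorem reflection_reflection (i : ι) (v : ι →₀ ℝ) :
    reflection M i (reflection M i v) = v := by
  simp only [reflection_eq, map_sub, map_smul, pairing_simpleRoot, rootForm_self, smul_eq_mul]
  module

theorem reflection_comm {i j : ι} (h : M i j = 2) (v : ι →₀ ℝ) :
    reflection M i (reflection M j v) = reflection M j (reflection M i v) := by
  simp only [reflection_eq, map_sub, map_smul, pairing_simpleRoot, rootForm_of_two h,
    rootForm_of_two (symm_eq h), smul_eq_mul]
  module

theorem reflection_braid {i j : ι} (h : M i j = 3) (v : ι →₀ ℝ) :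
    reflection M i (reflection M j (reflection M i v)) =
      reflection M j (reflection M i (reflection M j v)) := by
  simp only [reflection_eq, map_sub, map_smul, pairing_simpleRoot, rootForm_of_three h,
    rootForm_of_three (symm_eq h), rootForm_self, smul_eq_mul]
  module

theorem reflection_simpleRoot_self (i : ι) :
    reflection M i (simpleRoot i) = -simpleRoot i := by
  rw [reflection_eq, pairing_simpleRoot, rootForm_self]
  module

theorem reflection_simpleRoot_of_two {i j : ι} (h : M i j = 2) :
    reflection M i (simpleRoot j) = simpleRoot j := by
  rw [reflection_eq, pairing_simpleRoot, rootForm_of_two h]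
  module

theorem reflection_simpleRoot_of_three {i j : ι} (h : M i j = 3) :
    reflection M i (simpleRoot j) = simpleRoot i + simpleRoot j := by
  rw [reflection_eq, pairing_simpleRoot, rootForm_of_three h]
  module

/-- Apply the fundamental reflections of a word, the first letter first. -/
def act (M : CoxeterMatrix ι) : List ι → (ι →₀ ℝ) → (ι →₀ ℝ)
  | [], v => v
  | i :: u, v => act M u (reflection M i v)

theorem act_add (u : List ι) (v w : ι →₀ ℝ) : act M u (v + w) = act M u v + act M u w := by
  induction u generalizing v w with
  | nil => rfl
  | cons i u ih => simp only [act, reflection_add, ih]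

theorem act_neg (u : List ι) (v : ι →₀ ℝ) : act M u (-v) = -act M u v := by
  induction u generalizing v with
  | nil => rfl
  | cons i u ih => simp only [act, reflection_neg, ih]

theorem act_append (u w : List ι) (v : ι →₀ ℝ) :
    act M (u ++ w) v = act M w (act M u v) := by
  induction u generalizing v with
  | nil => rfl
  | cons i u ih => exact ih _

theorem act_injective (u : List ι) : Function.Injective (act M u) := by
  induction u with
  | nil => exact fun _ _ h => h
  | cons i u ih =>
    intro v w h
    have h' := ih h
    rw [← reflection_reflection i v, h', reflection_reflection]

theorem isRoot_act (u : List ι) {v : ι →₀ ℝ} (h : IsRoot M v) : IsRoot M (act M u v) := by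
  induction u generalizing v with
  | nil => exact h
  | cons i u ih => exact ih (.reflect i v h)

theorem BraidEquiv.act_eq {u w : List ι} (h : BraidEquiv M u w) (v : ι →₀ ℝ) :
    act M u v = act M w v := by
  induction h generalizing v with
  | refl u => rfl
  | cons i _ ih => exact ih _
  | comm h u => simp only [act, reflection_comm h]
  | braid h u => simp only [act, reflection_braid h]
  | trans _ _ ih₁ ih₂ => exact (ih₁ v).trans (ih₂ v)

/-- The list of roots attached to a word: one for each letter, namely the image of its simple
root under the reflections that follow it. -/
def rootSeq (M : CoxeterMatrix ι) : List ι → List (ι →₀ ℝ)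
  | [] => []
  | i :: u => act M u (simpleRoot i) :: rootSeq M u

theorem length_rootSeq (u : List ι) : (rootSeq M u).length = u.length := by
  induction u with
  | nil => rfl
  | cons i u ih => simp [rootSeq, ih]

theorem isRoot_of_mem_rootSeq {u : List ι} {β : ι →₀ ℝ} (h : β ∈ rootSeq M u) : IsRoot M β := by
  induction u with
  | nil => simp [rootSeq] at h
  | cons i u ih =>
    rcases List.mem_cons.1 h with rfl | h
    · exact isRoot_act u (.simple i)
    · exact ih h

theorem exists_of_mem_rootSeq {u : List ι} {β : ι →₀ ℝ} (h : β ∈ rootSeq M u) :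
    ∃ a k b, u = a ++ k :: b ∧ β = act M b (simpleRoot k) := by
  induction u with
  | nil => simp [rootSeq] at h
  | cons i u ih =>
    rcases List.mem_cons.1 h with rfl | h
    · exact ⟨[], i, u, rfl, rfl⟩
    · obtain ⟨a, k, b, rfl, rfl⟩ := ih h
      exact ⟨i :: a, k, b, rfl, rfl⟩

/-- A commutation swaps two neighbouring roots. A braid move reverses three: both sides list the
images of `α_i`, `α_i + α_j`, `α_j`. -/
theorem BraidEquiv.rootSeq_perm {u w : List ι} (h : BraidEquiv M u w) :
    (rootSeq M u).Perm (rootSeq M w) := by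
  induction h with
  | refl u => exact .refl _
  | cons i h ih =>
    rw [rootSeq, rootSeq, h.act_eq]
    exact ih.cons _
  | comm h u =>
    simp only [rootSeq, act, reflection_simpleRoot_of_two h,
      reflection_simpleRoot_of_two (symm_eq h)]
    exact .swap _ _ _
  | @braid i j h u =>
    simp only [rootSeq, act, reflection_simpleRoot_of_three h,
      reflection_simpleRoot_of_three (symm_eq h), reflection_add, reflection_simpleRoot_self]
    rw [add_comm (simpleRoot j) (simpleRoot i), add_neg_cancel_comm,
      add_neg_cancel_right]
    exact ((List.Perm.swap _ _ _).trans ((List.Perm.swap _ _ _).cons _)).trans (.swap _ _ _)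
  | trans _ _ ih₁ ih₂ => exact ih₁.trans ih₂

/-- All roots attached to the word are nonnegative. -/
def IsPositive (M : CoxeterMatrix ι) (u : List ι) : Prop := ∀ β ∈ rootSeq M u, 0 ≤ β

theorem BraidEquiv.isPositive {u w : List ι} (h : BraidEquiv M u w) (hu : IsPositive M u) :
    IsPositive M w :=
  fun β hβ => hu β (h.rootSeq_perm.mem_iff.2 hβ)

theorem IsPositive.of_cons {i : ι} {u : List ι} (h : IsPositive M (i :: u)) : IsPositive M u :=
  fun β hβ => h β (List.mem_cons_of_mem _ hβ)

theorem IsPositive.of_append {a b : List ι} (h : IsPositive M (a ++ b)) : IsPositive M b := by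
  induction a with
  | nil => exact h
  | cons i a ih => exact ih h.of_cons

/-- An exchange property obtained by braid moves alone, with no appeal to the length function of
`W`. -/
theorem IsPositive.nonneg_or_exists (hM : IsSimplyLaced M) {u : List ι} (hu : IsPositive M u)
    (i : ι) : 0 ≤ act M u (simpleRoot i) ∨ ∃ w, BraidEquiv M u (i :: w) := by
  induction hn : u.length using Nat.strong_induction_on generalizing u i with
  | _ n IH =>
  subst hn
  cases u with
  | nil => exact .inl (Finsupp.single_nonneg.2 zero_le_one)
  | cons j u =>
    by_cases hij : j = i
    · subst hij
      exact .inr ⟨u, .refl _⟩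
    have hu' := IH u.length (by simp) hu.of_cons i rfl
    rcases hM j i hij with h2 | h3
    · rcases hu' with hpos | ⟨w, hw⟩
      · left
        rwa [act, reflection_simpleRoot_of_two h2]
      · exact .inr ⟨j :: w, (hw.cons j).trans (.comm h2 w)⟩
    · have hj : 0 ≤ act M u (simpleRoot j) := hu _ List.mem_cons_self
      rw [act, reflection_simpleRoot_of_three h3, act_add]
      rcases hu' with hpos | ⟨w, hw⟩
      · exact .inl (add_nonneg hj hpos)
      -- Since `s_i (α_i + α_j) = α_j`, the question passes to the shorter word `w` and the node
      -- `j`. If `w` braids to `j w'`, then `j i j w'` braids to `i j i w'`.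
      · have hlen := hw.length_eq
        rw [← act_add, hw.act_eq, act, reflection_add, reflection_simpleRoot_self,
          reflection_simpleRoot_of_three (symm_eq h3), add_neg_cancel_comm]
        rcases IH w.length (by simp at hlen ⊢; omega) (hw.isPositive hu.of_cons).of_cons j rfl with
          hpos | ⟨w', hw'⟩
        · exact .inl hpos
        · exact .inr ⟨j :: i :: w', (hw.cons j).trans (((hw'.cons i).cons j).trans (.braid h3 w'))⟩

/-- At the shortest suffix `i :: u` that fails to be positive, the exchange property brings `i` to
the front of `u`. -/
theorem exists_square_of_not_isPositive (hM : IsSimplyLaced M) {u : List ι}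
    (hu : ¬ IsPositive M u) : ∃ a k b, BraidEquiv M u (a ++ k :: k :: b) := by
  induction u with
  | nil => exact (hu (by simp [IsPositive, rootSeq])).elim
  | cons i u ih =>
    by_cases h : IsPositive M u
    · rcases h.nonneg_or_exists hM i with hpos | ⟨w, hw⟩
      · refine (hu fun β hβ => ?_).elim
        rcases List.mem_cons.1 hβ with rfl | hβ
        exacts [hpos, h β hβ]
      · exact ⟨[], i, w, hw.cons i⟩
    · obtain ⟨a, k, b, hw⟩ := ih h
      exact ⟨i :: a, k, b, hw.cons i⟩

theorem not_nonneg_neg_simpleRoot (i : ι) : ¬ 0 ≤ -simpleRoot i := by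
  intro h
  have := h i
  simp at this
  linarith

/-- The two letters `k` contribute opposite roots; both being nonnegative would make a root zero. -/
theorem not_isPositive_square (a : List ι) (k : ι) (b : List ι) :
    ¬ IsPositive M (a ++ k :: k :: b) := by
  intro h
  have h := h.of_append
  have h1 := h _ List.mem_cons_self
  have h2 := h.of_cons _ List.mem_cons_self
  rw [act, reflection_simpleRoot_self, act_neg, neg_nonneg] at h1
  have h0 : act M b (simpleRoot k) = act M b 0 := by
    have h3 := act_add (M := M) b 0 0
    rw [add_zero, left_eq_add] at h3
    rw [le_antisymm h1 h2, h3]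
  simpa using act_injective b h0

theorem IsPositive.nodup_rootSeq (hM : IsSimplyLaced M) {u : List ι} (hu : IsPositive M u) :
    (rootSeq M u).Nodup := by
  induction u with
  | nil => exact List.nodup_nil
  | cons j u ih =>
    refine List.nodup_cons.2 ⟨fun hmem => ?_, ih hu.of_cons⟩
    obtain ⟨a, k, b, rfl, hb⟩ := exists_of_mem_rootSeq hmem
    rw [act_append, act] at hb
    -- A repeated root forces `act M a α_j = -α_k`, although this is the leading root of the
    -- positive word `j :: a`.
    have hk := congrArg (reflection M k) (act_injective b hb)
    rw [reflection_reflection, reflection_simpleRoot_self] at hk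
    have hpos : IsPositive M (j :: a) := by
      by_contra hneg
      obtain ⟨a', k', b', h⟩ := exists_square_of_not_isPositive hM hneg
      have := (h.append_right (k :: b)).isPositive hu
      rw [List.append_assoc] at this
      exact not_isPositive_square a' k' _ this
    exact not_nonneg_neg_simpleRoot k (hk ▸ hpos _ List.mem_cons_self)

theorem exists_square_of_ncard_lt (hM : IsSimplyLaced M) (hfin : (positiveRoots M).Finite)
    {u : List ι} (hu : (positiveRoots M).ncard < u.length) :
    ∃ a k b, BraidEquiv M u (a ++ k :: k :: b) := by
  classical
  refine exists_square_of_not_isPositive hM fun hpos => hu.not_ge ?_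
  rw [← length_rootSeq (M := M), ← List.toFinset_card_of_nodup (hpos.nodup_rootSeq hM),
    ← Set.ncard_coe_finset]
  refine Set.ncard_le_ncard (fun β hβ => ?_) hfin
  have hβ : β ∈ rootSeq M u := by simpa using hβ
  exact ⟨isRoot_of_mem_rootSeq hβ, hpos β hβ⟩

/-- The fundamental reflection as a permutation of the root space. -/
def reflectionPerm (M : CoxeterMatrix ι) (i : ι) : Equiv.Perm (ι →₀ ℝ) :=
  Function.Involutive.toPerm (reflection M i) (reflection_reflection i)

theorem reflectionPerm_apply (i : ι) (v : ι →₀ ℝ) : reflectionPerm M i v = reflection M i v :=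
  rfl

theorem isLiftable_reflectionPerm (hM : IsSimplyLaced M) : M.IsLiftable (reflectionPerm M) := by
  intro i j
  ext1 v
  by_cases hij : i = j
  · subst hij
    simp [reflectionPerm_apply, reflection_reflection]
  rcases hM i j hij with h | h
  · simp [h, pow_succ, reflectionPerm_apply, reflection_comm h, reflection_reflection]
  · simp only [h, pow_succ, pow_zero, one_mul, reflectionPerm_apply, Equiv.Perm.mul_apply,
      Equiv.Perm.one_apply]
    -- Braiding the innermost three reflections turns `(s_i s_j)³` into `s_i s_j s_i s_i s_j s_i`,
    -- which cancels.
    rw [← reflection_braid h v, reflection_reflection, reflection_reflection,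
      reflection_reflection]

theorem finite_positiveRoots [Finite ι] (hM : IsSimplyLaced M) (hW : IsSpherical M) :
    (positiveRoots M).Finite := by
  have : Finite M.Group := hW
  set ρ := M.toCoxeterSystem.lift ⟨_, isLiftable_reflectionPerm hM⟩ with hρ
  refine (Set.finite_range fun p : M.Group × ι => ρ p.1 (simpleRoot p.2)).subset ?_
  rintro v ⟨hv, -⟩
  induction hv with
  | simple i => exact ⟨(1, i), by simp⟩
  | reflect i v _ ih =>
    obtain ⟨⟨w, j⟩, rfl⟩ := ih
    refine ⟨(M.toCoxeterSystem.simple i * w, j), ?_⟩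
    simp only [map_mul, Equiv.Perm.mul_apply, hρ]
    rw [M.toCoxeterSystem.lift_apply_simple (isLiftable_reflectionPerm hM) i]
    rfl

end Roots

/-! ### Nonvanishing of the parameters. -/

theorem lPar_ne_zero : lPar ≠ 0 := by
  simp [lPar]

theorem algebraMap_ne_of_eval_ne {p q : MvPolynomial (Fin 2) ℚ} (a : Fin 2 → ℚ)
    (h : MvPolynomial.eval a p ≠ MvPolynomial.eval a q) :
    algebraMap _ Scalars p ≠ algebraMap _ Scalars q :=
  fun hpq => h (congrArg _ (IsFractionRing.injective (MvPolynomial (Fin 2) ℚ) Scalars hpq))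

theorem one_sub_xPar_ne_zero : 1 - xPar ≠ 0 := by
  have := algebraMap_ne_of_eval_ne (p := 1) (q := MvPolynomial.X 1) 0 (by simp)
  rw [map_one] at this
  exact sub_ne_zero.2 this

theorem mPar_ne_zero : mPar ≠ 0 := by
  have := algebraMap_ne_of_eval_ne (p := MvPolynomial.X 0 ^ 2) (q := 1) 0 (by simp)
  rw [map_one, map_pow] at this
  refine div_ne_zero (fun h => this ?_) one_sub_xPar_ne_zero
  change lPar ^ 2 = 1
  have hl := lPar_ne_zero
  field_simp at h
  linear_combination h

/-- `1 + l m = (l² - x) / (1 - x)`, and `l² ≠ x` is seen at `l = 1`, `x = 0`. -/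
theorem one_add_lPar_mul_mPar_ne_zero : 1 + lPar * mPar ≠ 0 := by
  have := algebraMap_ne_of_eval_ne (p := MvPolynomial.X 0 ^ 2) (q := MvPolynomial.X 1)
    ![1, 0] (by simp)
  rw [map_pow] at this
  change lPar ^ 2 ≠ xPar at this
  intro h
  apply this
  have hl := lPar_ne_zero
  have hx := one_sub_xPar_ne_zero
  rw [mPar] at h
  field_simp at h
  linear_combination h

theorem adj_symm {ι : Type*} {M : CoxeterMatrix ι} {i j : ι} (h : Adj M i j) : Adj M j i :=
  (M.symmetric j i).trans h

/-! ### Consequences of the defining relations. -/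

section Relations

variable {ι K A : Type*} [Field K] [Ring A] [Algebra K A] {l m : K} {M : CoxeterMatrix ι}

/-- Elements `a i`, `b i` of an algebra that satisfy the defining relations of `B(M)` for
`g_i`, `e_i`, with generic enough parameters. -/
structure BMWRelations (l m : K) (M : CoxeterMatrix ι) (a b : ι → A) : Prop where
  l_ne_zero : l ≠ 0
  m_ne_zero : m ≠ 0
  one_add_ne_zero : 1 + l * m ≠ 0
  comm : ∀ i j, ¬ Adj M i j → a i * a j = a j * a i
  braid : ∀ i j, Adj M i j → a i * a j * a i = a j * a i * a j
  smul_b : ∀ i, m • b i = l • (a i ^ 2 + m • a i - 1)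
  a_mul_b : ∀ i, a i * b i = l⁻¹ • b i
  b_mul_a_mul_b : ∀ i j, Adj M i j → b i * a j * b i = l • b i

end Relations

section Algebra

variable {ι K A : Type*} [Field K] [Ring A] [Algebra K A] {l m : K} {M : CoxeterMatrix ι} {g e : ι → A}

namespace BMWRelations

theorem e_eq (R : BMWRelations l m M g e) (i : ι) :
    e i = (m⁻¹ * l) • (g i ^ 2 + m • g i - 1) := by
  rw [mul_smul, ← R.smul_b, smul_smul, inv_mul_cancel₀ R.m_ne_zero, one_smul]

/-- An element that intertwines `g_i` and `g_j` intertwines `e_i` and `e_j`. -/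
theorem mul_e_of_mul_g (R : BMWRelations l m M g e) {i j : ι} {a : A} (h : a * g i = g j * a) :
    a * e i = e j * a := by
  have h2 : a * g i ^ 2 = g j ^ 2 * a := by
    rw [pow_two, pow_two, ← mul_assoc, h, mul_assoc, h, mul_assoc]
  rw [R.e_eq, R.e_eq, mul_smul_comm, smul_mul_assoc, mul_sub, mul_add, sub_mul, add_mul, h2,
    mul_smul_comm, smul_mul_assoc, h, mul_one, one_mul]

theorem e_mul_g (R : BMWRelations l m M g e) (i : ι) : e i * g i = l⁻¹ • e i := by
  rw [← R.a_mul_b, R.mul_e_of_mul_g rfl]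

theorem g_sq (R : BMWRelations l m M g e) (i : ι) :
    g i * g i = 1 - m • g i + (m * l⁻¹) • e i := by
  have h := congrArg (l⁻¹ • ·) (R.smul_b i)
  simp only [smul_smul, inv_mul_cancel₀ R.l_ne_zero, one_smul] at h
  rw [mul_comm m, h]
  noncomm_ring

/-- For `m = (l - l⁻¹) / (1 - x)` the scalar is `x`. -/
theorem e_sq (R : BMWRelations l m M g e) (i : ι) :
    e i * e i = (m⁻¹ * (l⁻¹ + m - l)) • e i := by
  have h : m • (e i * e i) = (l⁻¹ + m - l) • e i := by
    rw [← smul_mul_assoc, R.smul_b, smul_mul_assoc, sub_mul, add_mul, pow_two, mul_assoc,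
      R.a_mul_b, smul_mul_assoc, mul_smul_comm, R.a_mul_b, one_mul]
    have hl := R.l_ne_zero
    match_scalars
    field_simp
  rw [mul_smul, ← h, smul_smul, inv_mul_cancel₀ R.m_ne_zero, one_smul]

/-- The inverse of `g_i`. -/
def gInv (_ : BMWRelations l m M g e) (i : ι) : A := g i + m • 1 - m • e i

theorem g_mul_gInv (R : BMWRelations l m M g e) (i : ι) : g i * R.gInv i = 1 := by
  rw [gInv, mul_sub, mul_add, R.g_sq, mul_smul_comm, mul_smul_comm, R.a_mul_b, mul_one]
  module

theorem gInv_mul_g (R : BMWRelations l m M g e) (i : ι) : R.gInv i * g i = 1 := by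
  rw [gInv, sub_mul, add_mul, R.g_sq, smul_mul_assoc, smul_mul_assoc, R.e_mul_g, one_mul]
  module

theorem g_mul_cancel (R : BMWRelations l m M g e) (i : ι) (a : A) :
    g i * (R.gInv i * a) = a := by
  rw [← mul_assoc, g_mul_gInv, one_mul]

theorem gInv_mul_cancel (R : BMWRelations l m M g e) (i : ι) (a : A) :
    R.gInv i * (g i * a) = a := by
  rw [← mul_assoc, gInv_mul_g, one_mul]

theorem gInv_mul_e (R : BMWRelations l m M g e) (i : ι) : R.gInv i * e i = l • e i := by
  have h := congrArg (fun a => l • (R.gInv i * a)) (R.a_mul_b i)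
  simpa [gInv_mul_cancel, smul_smul, R.l_ne_zero] using h.symm

section Adjacent

variable {i j : ι}

/-- The braid relation says that `g_i g_j` intertwines `g_i` with `g_j`, hence also `e_i` with
`e_j`. -/
theorem g_mul_g_mul_e (R : BMWRelations l m M g e) (h : Adj M i j) :
    g i * (g j * e i) = e j * (g i * g j) := by
  rw [← mul_assoc, R.mul_e_of_mul_g ((R.braid i j h).trans (mul_assoc _ _ _))]

/-- Write `e_i` as the conjugate of `e_j` by `g_j g_i`; then `e_j g_j g_i e_j` collapses to `e_j`.
-/
theorem e_mul_e_eq_left (R : BMWRelations l m M g e) (h : Adj M i j) :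
    e j * e i = e j * (R.gInv i * R.gInv j) := by
  have h1 : e i = g j * (g i * (e j * (R.gInv i * R.gInv j))) := by
    simp only [← mul_assoc (g i) (e j), ← mul_assoc (g j) (g i * e j),
      R.g_mul_g_mul_e (adj_symm h)]
    simp only [mul_assoc, g_mul_cancel, g_mul_gInv, mul_one]
  conv_lhs => rw [h1]
  rw [← mul_assoc, R.e_mul_g, smul_mul_assoc, ← mul_assoc, ← mul_assoc,
    R.b_mul_a_mul_b j i (adj_symm h), smul_mul_assoc, smul_smul, inv_mul_cancel₀ R.l_ne_zero,
    one_smul]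

theorem e_mul_e_eq_right (R : BMWRelations l m M g e) (h : Adj M i j) :
    e i * e j = R.gInv j * (R.gInv i * e j) := by
  have h1 : e i = R.gInv j * (R.gInv i * (e j * (g i * g j))) := by
    rw [← R.g_mul_g_mul_e h, gInv_mul_cancel, gInv_mul_cancel]
  conv_lhs => rw [h1]
  simp only [mul_assoc, R.a_mul_b, mul_smul_comm]
  rw [← mul_assoc (e j), R.b_mul_a_mul_b j i (adj_symm h)]
  simp only [mul_smul_comm, smul_smul, inv_mul_cancel₀ R.l_ne_zero, one_smul]

/-- Expanding `g_i⁻¹` in `e_j e_i e_j = l e_j g_i⁻¹ e_j` gives a linear equation for `e_j e_i e_j`,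
solvable because `1 + l m ≠ 0`. -/
theorem e_mul_e_mul_e (R : BMWRelations l m M g e) (h : Adj M i j) :
    e j * e i * e j = e j := by
  have h1 : e j * e i * e j = l • (e j * R.gInv i * e j) := by
    rw [R.e_mul_e_eq_left h]
    simp only [mul_assoc, gInv_mul_e, mul_smul_comm]
  have h2 : e j * R.gInv i * e j = l • e j +
      (l⁻¹ + m - l) • e j - m • (e j * e i * e j) := by
    rw [gInv, mul_sub, mul_add, sub_mul, add_mul, R.b_mul_a_mul_b j i (adj_symm h),
      mul_smul_comm, mul_one, smul_mul_assoc, R.e_sq, mul_smul_comm, smul_mul_assoc, smul_smul,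
      mul_inv_cancel_left₀ R.m_ne_zero]
  have h3 : (1 + l * m) • (e j * e i * e j) = (1 + l * m) • e j := by
    rw [add_smul, one_smul, mul_smul]
    nth_rw 1 [h1]
    rw [h2]
    simp only [smul_sub, smul_smul, sub_add_cancel, ← add_smul]
    congr 1
    linear_combination mul_inv_cancel₀ R.l_ne_zero
  exact smul_right_injective _ R.one_add_ne_zero h3

theorem e_mul_g_mul_g (R : BMWRelations l m M g e) (h : Adj M i j) :
    e j * (g i * g j) = e j * e i := by
  have h1 := R.e_mul_e_mul_e h
  rw [mul_assoc, R.e_mul_e_eq_left (adj_symm h), ← mul_assoc] at h1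
  conv_lhs => rw [← h1]
  simp only [mul_assoc, gInv_mul_cancel, gInv_mul_g, mul_one]

theorem e_mul_e_mul_g (R : BMWRelations l m M g e) (h : Adj M i j) :
    e j * (e i * g j) = e j * R.gInv i := by
  rw [← mul_assoc, R.e_mul_e_eq_left h]
  simp only [mul_assoc, gInv_mul_g, mul_one]

theorem g_mul_e_mul_e (R : BMWRelations l m M g e) (h : Adj M i j) :
    g j * (e i * e j) = R.gInv i * e j := by
  rw [R.e_mul_e_eq_right h, g_mul_cancel]

theorem g_mul_e_mul_g (R : BMWRelations l m M g e) (h : Adj M i j) :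
    g j * (e i * g j) = R.gInv i * (e j * R.gInv i) := by
  calc g j * (e i * g j) = R.gInv i * ((g i * (g j * e i)) * g j) := by
        simp only [mul_assoc, gInv_mul_cancel]
    _ = R.gInv i * (e j * (e i * g j)) := by
        rw [R.g_mul_g_mul_e h, R.e_mul_g_mul_g h, mul_assoc]
    _ = R.gInv i * (e j * R.gInv i) := by rw [R.e_mul_e_mul_g h]

end Adjacent

end BMWRelations

end Algebra

theorem bmwRelations {ι : Type*} (M : CoxeterMatrix ι) : BMWRelations lPar mPar M (g M) (e M) where
  l_ne_zero := lPar_ne_zero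
  m_ne_zero := mPar_ne_zero
  one_add_ne_zero := one_add_lPar_mul_mPar_ne_zero
  comm i j h := by
    simpa only [g, e, map_mul] using RingQuot.mkAlgHom_rel Scalars (Rel.B1 i j h)
  braid i j h := by
    simpa only [g, e, map_mul] using RingQuot.mkAlgHom_rel Scalars (Rel.B2 i j h)
  smul_b i := by
    simpa only [g, e, map_smul, map_sub, map_add, map_pow, map_one] using
      RingQuot.mkAlgHom_rel Scalars (Rel.D1 (M := M) i)
  a_mul_b i := by
    simpa only [g, e, map_mul, map_smul] using RingQuot.mkAlgHom_rel Scalars (Rel.R1 (M := M) i)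
  b_mul_a_mul_b i j h := by
    simpa only [g, e, map_mul, map_smul] using RingQuot.mkAlgHom_rel Scalars (Rel.R2 i j h)

/-! ### Products of node spans modulo shorter products. -/

namespace BMWRelations

variable {ι K A : Type*} [Field K] [Ring A] [Algebra K A] {l m : K} {M : CoxeterMatrix ι}
  {g e : ι → A}

theorem isUnit_g (R : BMWRelations l m M g e) (i : ι) : IsUnit (g i) :=
  ⟨⟨g i, R.gInv i, R.g_mul_gInv i, R.gInv_mul_g i⟩, rfl⟩

theorem inverse_g (R : BMWRelations l m M g e) (i : ι) : Ring.inverse (g i) = R.gInv i :=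
  Ring.inverse_unit ⟨g i, R.gInv i, R.g_mul_gInv i, R.gInv_mul_g i⟩

/-- The linear span of `1, g_i, e_i`. -/
def nodeSpan (_ : BMWRelations l m M g e) (i : ι) : Submodule K A :=
  Submodule.span K {1, g i, e i}

theorem one_mem_nodeSpan (R : BMWRelations l m M g e) (i : ι) : 1 ∈ R.nodeSpan i :=
  Submodule.subset_span (by simp)

theorem g_mem_nodeSpan (R : BMWRelations l m M g e) (i : ι) : g i ∈ R.nodeSpan i :=
  Submodule.subset_span (by simp)

theorem e_mem_nodeSpan (R : BMWRelations l m M g e) (i : ι) : e i ∈ R.nodeSpan i :=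
  Submodule.subset_span (by simp)

theorem gInv_mem_nodeSpan (R : BMWRelations l m M g e) (i : ι) : R.gInv i ∈ R.nodeSpan i :=
  sub_mem (add_mem (R.g_mem_nodeSpan i) (Submodule.smul_mem _ _ (R.one_mem_nodeSpan i)))
    (Submodule.smul_mem _ _ (R.e_mem_nodeSpan i))

theorem nodeSpan_mul_self_le (R : BMWRelations l m M g e) (i : ι) :
    R.nodeSpan i * R.nodeSpan i ≤ R.nodeSpan i := by
  have h1 := R.one_mem_nodeSpan i
  have hg := R.g_mem_nodeSpan i
  have he := R.e_mem_nodeSpan i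
  conv_lhs => rw [nodeSpan, Submodule.span_mul_span]
  refine Submodule.span_le.2 ?_
  rintro _ ⟨a, ha, b, hb, rfl⟩
  rcases ha with rfl | rfl | rfl <;> rcases hb with rfl | rfl | rfl <;>
    simp only [one_mul, mul_one, SetLike.mem_coe, R.g_sq, R.a_mul_b, R.e_mul_g, R.e_sq]
  · exact h1
  · exact hg
  · exact he
  · exact hg
  · exact add_mem (sub_mem h1 (Submodule.smul_mem _ _ hg)) (Submodule.smul_mem _ _ he)
  · exact Submodule.smul_mem _ _ he
  · exact he
  · exact Submodule.smul_mem _ _ he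
  · exact Submodule.smul_mem _ _ he

theorem nodeSpan_mul_comm_le (R : BMWRelations l m M g e) {i j : ι} (h : ¬ Adj M i j) :
    R.nodeSpan i * R.nodeSpan j ≤ R.nodeSpan j * R.nodeSpan i := by
  have hgg := R.comm i j h
  have hge := R.mul_e_of_mul_g hgg
  have heg := R.mul_e_of_mul_g hgg.symm
  have hee := R.mul_e_of_mul_g hge.symm
  conv_lhs => rw [nodeSpan, nodeSpan, Submodule.span_mul_span]
  refine Submodule.span_le.2 ?_
  rintro _ ⟨a, ha, b, hb, rfl⟩
  have hab : a * b = b * a := by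
    rcases ha with rfl | rfl | rfl <;> rcases hb with rfl | rfl | rfl <;>
      simp only [one_mul, mul_one, hgg, hge, heg, hee]
  change a * b ∈ _
  rw [hab]
  exact Submodule.mul_mem_mul (Submodule.subset_span hb) (Submodule.subset_span ha)

theorem nodeSpan_braid_le (R : BMWRelations l m M g e) {i j : ι} (h : Adj M i j)
    {F : Submodule K A} (hF : ∀ k, R.nodeSpan k ≤ F) :
    R.nodeSpan i * (R.nodeSpan j * R.nodeSpan i) ≤
      R.nodeSpan j * (R.nodeSpan i * R.nodeSpan j) ⊔ F * F := by
  have two {x y : A} {k k' : ι} (hx : x ∈ R.nodeSpan k) (hy : y ∈ R.nodeSpan k') :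
      x * y ∈ R.nodeSpan j * (R.nodeSpan i * R.nodeSpan j) ⊔ F * F :=
    Submodule.mem_sup_right (Submodule.mul_mem_mul (hF _ hx) (hF _ hy))
  have three {x y z : A} (hx : x ∈ R.nodeSpan j) (hy : y ∈ R.nodeSpan i)
      (hz : z ∈ R.nodeSpan j) :
      x * (y * z) ∈ R.nodeSpan j * (R.nodeSpan i * R.nodeSpan j) ⊔ F * F :=
    Submodule.mem_sup_left (Submodule.mul_mem_mul hx (Submodule.mul_mem_mul hy hz))
  have one {x : A} {k : ι} (hx : x ∈ R.nodeSpan k) :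
      x ∈ R.nodeSpan j * (R.nodeSpan i * R.nodeSpan j) ⊔ F * F := by
    simpa using two hx (R.one_mem_nodeSpan k)
  have h' := adj_symm h
  have hg := R.g_mem_nodeSpan
  have he := R.e_mem_nodeSpan
  have hI := R.gInv_mem_nodeSpan
  conv_lhs => rw [nodeSpan, nodeSpan, Submodule.span_mul_span, Submodule.span_mul_span]
  refine Submodule.span_le.2 ?_
  rintro _ ⟨a, ha, _, ⟨b, hb, c, hc, rfl⟩, rfl⟩
  have hb' : b ∈ R.nodeSpan j := Submodule.subset_span hb
  have hc' : c ∈ R.nodeSpan i := Submodule.subset_span hc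
  have ha' : a ∈ R.nodeSpan i := Submodule.subset_span ha
  change a * (b * c) ∈ R.nodeSpan j * (R.nodeSpan i * R.nodeSpan j) ⊔ F * F
  rcases ha with rfl | rfl | rfl
  · rw [one_mul]; exact two hb' hc'
  all_goals
    rcases hb with rfl | rfl | rfl
    · rw [one_mul]; exact two ha' hc'
    all_goals
      rcases hc with rfl | rfl | rfl
      · rw [mul_one]; exact two ha' hb'
  -- Of the eight products in `g` and `e`, only `g g g` and `g e g` need three factors; the others
  -- collapse to at most two.
  · rw [← mul_assoc (g i), R.braid i j h, mul_assoc (g j)]; exact three (hg j) (hg i) (hg j)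
  · rw [R.g_mul_g_mul_e h, R.e_mul_g_mul_g h]; exact two (he j) (he i)
  · rw [R.g_mul_e_mul_g h']; exact three (hI j) (he i) (hI j)
  · rw [R.g_mul_e_mul_e h']; exact two (hI j) (he i)
  · rw [R.e_mul_g_mul_g h']; exact two (he i) (he j)
  · rw [← mul_assoc (e i), R.b_mul_a_mul_b i j h]; exact Submodule.smul_mem _ _ (one (he i))
  · rw [R.e_mul_e_mul_g h']; exact two (he i) (hI j)
  · rw [← mul_assoc (e i), R.e_mul_e_mul_e h']; exact one (he i)

/-- The product of the spans attached to the letters of a word in the nodes. -/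
def wordSpan (R : BMWRelations l m M g e) (u : List ι) : Submodule K A :=
  (u.map R.nodeSpan).prod

theorem wordSpan_cons (R : BMWRelations l m M g e) (i : ι) (u : List ι) :
    R.wordSpan (i :: u) = R.nodeSpan i * R.wordSpan u := by
  simp [wordSpan]

theorem wordSpan_append (R : BMWRelations l m M g e) (u v : List ι) :
    R.wordSpan (u ++ v) = R.wordSpan u * R.wordSpan v := by
  simp [wordSpan]

theorem wordSpan_le_pow (R : BMWRelations l m M g e) {F : Submodule K A}
    (hF : ∀ k, R.nodeSpan k ≤ F) (u : List ι) : R.wordSpan u ≤ F ^ u.length := by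
  induction u with
  | nil => simp [wordSpan]
  | cons i u ih =>
    rw [wordSpan_cons, List.length_cons, pow_succ']
    exact mul_le_mul' (hF i) ih

theorem wordSpan_le_of_braidEquiv (R : BMWRelations l m M g e) {F : Submodule K A}
    (hF : ∀ k, R.nodeSpan k ≤ F) {u v : List ι} (h : BraidEquiv M u v) :
    R.wordSpan u ≤ R.wordSpan v ⊔ F ^ (u.length - 1) := by
  induction h with
  | refl u => exact le_sup_left
  | @cons i u v h ih =>
    -- The empty word is separate: there `length - 1` truncates to `0`, and prepending a letter
    -- would not raise the exponent.
    rcases u with _ | ⟨k, u⟩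
    · rw [List.eq_nil_of_length_eq_zero h.length_eq.symm]
      exact le_sup_left
    · rw [wordSpan_cons _ i, wordSpan_cons _ i]
      refine (mul_le_mul' le_rfl ih).trans ?_
      rw [Submodule.mul_sup]
      refine sup_le_sup_left ((mul_le_mul' (hF i) le_rfl).trans ?_) _
      rw [← pow_succ']
      exact le_rfl
  | @comm i j h u =>
    refine le_sup_of_le_left ?_
    simp only [wordSpan_cons, ← mul_assoc]
    exact mul_le_mul' (R.nodeSpan_mul_comm_le (by simp [Adj, h])) le_rfl
  | @braid i j h u =>
    have := mul_le_mul' (R.nodeSpan_braid_le h hF) (le_refl (R.wordSpan u))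
    simp only [wordSpan_cons, Submodule.sup_mul, mul_assoc] at this ⊢
    refine this.trans (sup_le_sup_left ?_ _)
    rw [List.length_cons, Nat.add_sub_cancel, List.length_cons, List.length_cons, pow_succ',
      pow_succ']
    exact mul_le_mul' le_rfl (mul_le_mul' le_rfl (R.wordSpan_le_pow hF u))
  | trans h _ ih₁ ih₂ =>
    refine ih₁.trans (sup_le (ih₂.trans ?_) le_sup_right)
    rw [h.length_eq]

theorem wordSpan_le_of_ncard_lt (R : BMWRelations l m M g e) (hM : IsSimplyLaced M)
    (hfin : (positiveRoots M).Finite) {F : Submodule K A} (hF : ∀ k, R.nodeSpan k ≤ F)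
    {u : List ι} (hu : (positiveRoots M).ncard < u.length) :
    R.wordSpan u ≤ F ^ (u.length - 1) := by
  obtain ⟨a, k, b, h⟩ := exists_square_of_ncard_lt hM hfin hu
  refine (R.wordSpan_le_of_braidEquiv hF h).trans (sup_le ?_ le_rfl)
  calc R.wordSpan (a ++ k :: k :: b)
      = R.wordSpan a * (R.nodeSpan k * R.nodeSpan k * R.wordSpan b) := by
        rw [wordSpan_append, wordSpan_cons, wordSpan_cons, mul_assoc]
    _ ≤ R.wordSpan a * (R.nodeSpan k * R.wordSpan b) :=
        mul_le_mul' le_rfl (mul_le_mul' (R.nodeSpan_mul_self_le k) le_rfl)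
    _ = R.wordSpan (a ++ k :: b) := by rw [wordSpan_append, wordSpan_cons]
    _ ≤ F ^ (a ++ k :: b).length := R.wordSpan_le_pow hF _
    _ = F ^ (u.length - 1) := by rw [h.length_eq]; simp

end BMWRelations

/-! ### Words in the letters and finite dimension. -/

section Words

variable {ι : Type*} (M : CoxeterMatrix ι)

/-- The linear span of the words of length at most `n`. -/
def shortSpan (n : ℕ) : Submodule Scalars (BMW M) :=
  Submodule.span Scalars {b | ∃ v : List (Letter ι), v.length ≤ n ∧ b = wordVal M v}

variable {M}

theorem wordVal_append (v w : List (Letter ι)) :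
    wordVal M (v ++ w) = wordVal M v * wordVal M w := by
  simp [wordVal]

theorem wordVal_mem_shortSpan {v : List (Letter ι)} {n : ℕ} (h : v.length ≤ n) :
    wordVal M v ∈ shortSpan M n :=
  Submodule.subset_span ⟨v, h, rfl⟩

theorem shortSpan_mono {n k : ℕ} (h : n ≤ k) : shortSpan M n ≤ shortSpan M k :=
  Submodule.span_mono fun _ ⟨v, hv, hb⟩ => ⟨v, hv.trans h, hb⟩

theorem shortSpan_mul_le (n k : ℕ) : shortSpan M n * shortSpan M k ≤ shortSpan M (n + k) := by
  conv_lhs => rw [shortSpan, shortSpan, Submodule.span_mul_span]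
  refine Submodule.span_le.2 ?_
  rintro _ ⟨_, ⟨v, hv, rfl⟩, _, ⟨w, hw, rfl⟩, rfl⟩
  refine Submodule.subset_span ⟨v ++ w, ?_, (wordVal_append v w).symm⟩
  rw [List.length_append]
  exact add_le_add hv hw

theorem one_mem_shortSpan (n : ℕ) : (1 : BMW M) ∈ shortSpan M n :=
  Submodule.subset_span ⟨[], Nat.zero_le n, by simp [wordVal]⟩

theorem letterVal_mem_shortSpan (a : Letter ι) : letterVal M a ∈ shortSpan M 1 :=
  Submodule.subset_span ⟨[a], le_rfl, by simp [wordVal]⟩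

theorem shortSpan_one_pow_le (n : ℕ) : shortSpan M 1 ^ n ≤ shortSpan M n := by
  induction n with
  | zero => simpa using one_mem_shortSpan 0
  | succ n ih =>
    rw [pow_succ]
    exact (mul_le_mul' ih le_rfl).trans (shortSpan_mul_le n 1)

theorem nodeSpan_le_shortSpan (i : ι) : (bmwRelations M).nodeSpan i ≤ shortSpan M 1 := by
  refine Submodule.span_le.2 ?_
  rintro _ (rfl | rfl | rfl)
  exacts [one_mem_shortSpan 1, letterVal_mem_shortSpan (.g i), letterVal_mem_shortSpan (.e i)]

/-- The node of a letter. -/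
def Letter.node : Letter ι → ι
  | .g i => i
  | .gInv i => i
  | .e i => i

theorem letterVal_mem_nodeSpan (a : Letter ι) :
    letterVal M a ∈ (bmwRelations M).nodeSpan a.node := by
  cases a with
  | g i => exact (bmwRelations M).g_mem_nodeSpan i
  | gInv i =>
    rw [letterVal, (bmwRelations M).inverse_g]
    exact (bmwRelations M).gInv_mem_nodeSpan i
  | e i => exact (bmwRelations M).e_mem_nodeSpan i

theorem wordVal_mem_wordSpan (w : List (Letter ι)) :
    wordVal M w ∈ (bmwRelations M).wordSpan (w.map Letter.node) := by
  induction w with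
  | nil => exact Submodule.one_le.1 le_rfl
  | cons a w ih =>
    rw [List.map_cons, BMWRelations.wordSpan_cons]
    exact Submodule.mul_mem_mul (letterVal_mem_nodeSpan a) ih

theorem wordVal_mem_shortSpan_of_ncard_lt (hM : IsSimplyLaced M)
    (hfin : (positiveRoots M).Finite) {w : List (Letter ι)}
    (hw : (positiveRoots M).ncard < w.length) : wordVal M w ∈ shortSpan M (w.length - 1) := by
  have h := (bmwRelations M).wordSpan_le_of_ncard_lt hM hfin nodeSpan_le_shortSpan
    (u := w.map Letter.node) (by simpa using hw)
  rw [List.length_map] at h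
  exact shortSpan_one_pow_le _ (h (wordVal_mem_wordSpan w))

theorem shortSpan_le_ncard (hM : IsSimplyLaced M) (hfin : (positiveRoots M).Finite) (n : ℕ) :
    shortSpan M n ≤ shortSpan M (positiveRoots M).ncard := by
  induction n with
  | zero => exact shortSpan_mono (Nat.zero_le _)
  | succ n ih =>
    refine Submodule.span_le.2 ?_
    rintro _ ⟨v, hv, rfl⟩
    by_cases h : v.length ≤ (positiveRoots M).ncard
    · exact wordVal_mem_shortSpan h
    -- A word over the bound drops to length at most `n`, where induction applies.
    · exact ih (shortSpan_mono (by omega)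
        (wordVal_mem_shortSpan_of_ncard_lt hM hfin (not_le.1 h)))

theorem exists_mem_shortSpan (b : BMW M) : ∃ n, b ∈ shortSpan M n := by
  obtain ⟨a, rfl⟩ := RingQuot.mkAlgHom_surjective Scalars (Rel M) b
  induction a using FreeAlgebra.induction with
  | grade0 r =>
    refine ⟨0, ?_⟩
    rw [AlgHom.commutes, Algebra.algebraMap_eq_smul_one]
    exact Submodule.smul_mem _ _ (one_mem_shortSpan 0)
  | grade1 x =>
    cases x with
    | g i => exact ⟨1, letterVal_mem_shortSpan (.g i)⟩
    | e i => exact ⟨1, letterVal_mem_shortSpan (.e i)⟩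
  | mul a b ha hb =>
    obtain ⟨n, hn⟩ := ha
    obtain ⟨k, hk⟩ := hb
    rw [map_mul]
    exact ⟨n + k, shortSpan_mul_le n k (Submodule.mul_mem_mul hn hk)⟩
  | add a b ha hb =>
    obtain ⟨n, hn⟩ := ha
    obtain ⟨k, hk⟩ := hb
    rw [map_add]
    exact ⟨max n k, add_mem (shortSpan_mono (le_max_left n k) hn)
      (shortSpan_mono (le_max_right n k) hk)⟩

theorem finite_letter [Finite ι] : Finite (Letter ι) :=
  Finite.of_surjective
    (Sum.elim Letter.g (Sum.elim Letter.gInv Letter.e) : ι ⊕ ι ⊕ ι → Letter ι) fun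
      | .g i => ⟨.inl i, rfl⟩
      | .gInv i => ⟨.inr (.inl i), rfl⟩
      | .e i => ⟨.inr (.inr i), rfl⟩

theorem finite_bmw [Finite ι] (hM : IsSimplyLaced M) (hfin : (positiveRoots M).Finite) :
    Module.Finite Scalars (BMW M) := by
  have := finite_letter (ι := ι)
  have htop : shortSpan M (positiveRoots M).ncard = ⊤ := by
    refine eq_top_iff.2 fun b _ => ?_
    obtain ⟨n, hn⟩ := exists_mem_shortSpan b
    exact shortSpan_le_ncard hM hfin n hn
  refine ⟨?_⟩
  rw [← htop]
  refine Submodule.fg_span ?_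
  refine ((List.finite_length_le (Letter ι) (positiveRoots M).ncard).image (wordVal M)).subset ?_
  rintro _ ⟨v, hv, rfl⟩
  exact ⟨v, hv, rfl⟩

end Words

end SimplyLacedBMW

end

theorem mainTheorem2 {ι : Type*} [Finite ι] (M : CoxeterMatrix ι)
    (hlaced : SimplyLacedBMW.IsSimplyLaced M) (hsph : SimplyLacedBMW.IsSpherical M) :
    Module.Finite SimplyLacedBMW.Scalars (SimplyLacedBMW.BMW M) ∧
    (SimplyLacedBMW.positiveRoots M).Finite ∧
    (∀ i : ι, IsUnit (SimplyLacedBMW.g M i)) ∧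
    ∀ w : List (SimplyLacedBMW.Letter ι),
      (SimplyLacedBMW.positiveRoots M).ncard < w.length →
      SimplyLacedBMW.wordVal M w ∈ Submodule.span SimplyLacedBMW.Scalars
        {b : SimplyLacedBMW.BMW M | ∃ v : List (SimplyLacedBMW.Letter ι),
          v.length < w.length ∧ b = SimplyLacedBMW.wordVal M v} := by
  have hfin := SimplyLacedBMW.finite_positiveRoots hlaced hsph
  refine ⟨SimplyLacedBMW.finite_bmw hlaced hfin, hfin,
    fun i => (SimplyLacedBMW.bmwRelations M).isUnit_g i, fun w hw => ?_⟩
  refine Submodule.span_mono ?_ (SimplyLacedBMW.wordVal_mem_shortSpan_of_ncard_lt hlaced hfin hw)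
  rintro _ ⟨v, hv, rfl⟩
  -- `hw` makes `w` nonempty, so length at most `w.length - 1` is strictly shorter.
  exact ⟨v, by omega, rfl⟩
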